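/- For topological spaces $Y$ and $X$, a map $\varphi$ from $Y$ to the nonempty subsets of $X$ is lower semicontinuous if $\{y\in Y:\varphi(y)\cap U\neq\emptyset\}$ is open in $Y$ for every open $U\subseteq X$. A continuous selection of $\varphi$ is a continuous map $f:Y\to X$ with $f(y)\in\varphi(y)$ for all $y\in Y$. A $T_1$ space $X$ is called $L$-selective (respectively, strongly $L$-selective) if every lower semicontinuous map from the ordinal space $\omega+1$ to the nonempty closed subsets (respectively, to the nonempty subsets) of $X$ has a continuous selection. A space $X$ is Fréchet if every point in the closure of a set $A\subseteq X$ is the limit of a sequence of points of $A$. Assume the Continuum Hypothesis $2^{\aleph_0}=\aleph_1$. Then there is a countable $T_1$ space $X$ that is $L$-selective and Fréchet but not strongly $L$-selective. Consequently, the statement "every $T_1$ space $X$ is strongly $L$-selective if and only if $X$ is $L$-selective and Fréchet" is false. -/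

import Mathlib

/-- A selection of `φ : Y → Set X` that is continuous. -/
def IsContinuousSelection {Y X : Type*} [TopologicalSpace Y] [TopologicalSpace X]
    (φ : Y → Set X) (f : Y → X) : Prop :=
  Continuous f ∧ ∀ y, f y ∈ φ y

/-- `X` is `Y`-selective: every lower semicontinuous map from `Y` to the nonempty closed subsets
of `X` has a continuous selection. Lower semicontinuity of a set-valued map is called
`LowerHemicontinuous` in Mathlib; it says that `{y | (φ y ∩ U).Nonempty}` is open for every
open `U`. -/
def IsSelective (Y X : Type*) [TopologicalSpace Y] [TopologicalSpace X] : Prop :=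
  ∀ φ : Y → Set X, (∀ y, (φ y).Nonempty ∧ IsClosed (φ y)) → LowerHemicontinuous φ →
    ∃ f : Y → X, IsContinuousSelection φ f

/-- `X` is strongly `Y`-selective: every lower semicontinuous map from `Y` to the nonempty
subsets of `X` has a continuous selection. -/
def IsStronglySelective (Y X : Type*) [TopologicalSpace Y] [TopologicalSpace X] : Prop :=
  ∀ φ : Y → Set X, (∀ y, (φ y).Nonempty) → LowerHemicontinuous φ →
    ∃ f : Y → X, IsContinuousSelection φ f

/-- The ordinal space `ω + 1`: the set of ordinals below `ω + 1`, with its order topology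
(the topology induced from the order topology of the ordinals). -/
abbrev OmegaAddOne : Type 1 := Set.Iio (Ordinal.omega0.{0} + 1)

/-- `X` is `L`-selective: it is `(ω + 1)`-selective. -/
def IsLSelective (X : Type*) [TopologicalSpace X] : Prop :=
  IsSelective OmegaAddOne X

/-- `X` is strongly `L`-selective: it is strongly `(ω + 1)`-selective. -/
def IsStronglyLSelective (X : Type*) [TopologicalSpace X] : Prop :=
  IsStronglySelective OmegaAddOne X

open Set Filter Topology

/-! ### Meeting `ℵ₁` cofinal sets, and a diagonal argument -/

/-- In a preorder whose countable chains are bounded above, one can meet a well-ordered family of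
cofinal sets along a monotone map, if the proper initial segments of the index are countable. -/
theorem exists_monotone_forall_mem {T Q : Type*} [Preorder Q] [LinearOrder T] [WellFoundedLT T]
    (hT : ∀ t : T, (Iio t).Countable)
    (hQ : ∀ C : Set Q, C.Countable → IsChain (· ≤ ·) C → BddAbove C)
    (D : T → Set Q) (hD : ∀ t q, ∃ q' ∈ D t, q ≤ q') :
    ∃ g : T → Q, Monotone g ∧ ∀ t, g t ∈ D t := by
  classical
  obtain ⟨q₀, -⟩ := hQ ∅ countable_empty IsChain.empty
  let step (t : T) (r : ∀ s, s < t → Q) : Q :=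
    -- The default `q₀` is never used: `key` shows by induction that the earlier values form a
    -- countable chain.
    if h : ∃ q ∈ D t, ∀ s hs, r s hs ≤ q then h.choose else q₀
  let g : T → Q := (wellFounded_lt (α := T)).fix step
  have hg (t : T) : g t = step t fun s _ ↦ g s := (wellFounded_lt (α := T)).fix_eq step t
  have key (t : T) : g t ∈ D t ∧ ∀ s < t, g s ≤ g t := by
    induction t using WellFoundedLT.induction with
    | _ t ih =>
      have hchain : IsChain (· ≤ ·) (g '' Iio t) := by
        rintro _ ⟨a, ha, rfl⟩ _ ⟨b, hb, rfl⟩ -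
        rcases lt_trichotomy a b with h | rfl | h
        · exact Or.inl ((ih b hb).2 a h)
        · exact Or.inl le_rfl
        · exact Or.inr ((ih a ha).2 b h)
      obtain ⟨q, hq⟩ := hQ _ ((hT t).image g) hchain
      obtain ⟨q', hq', hle⟩ := hD t q
      have h : ∃ q ∈ D t, ∀ s, s < t → g s ≤ q :=
        ⟨q', hq', fun s hs ↦ (hq (mem_image_of_mem g hs)).trans hle⟩
      have he : g t = h.choose := by rw [hg]; exact dif_pos h
      rw [he]
      exact h.choose_spec
  refine ⟨g, fun s t hst ↦ ?_, fun t ↦ (key t).1⟩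
  rcases hst.eq_or_lt with rfl | h
  · exact le_rfl
  · exact (key t).2 s h

/-- The version of `exists_monotone_forall_mem` for a family of at most `ℵ₁` cofinal sets. -/
theorem exists_directed_forall_mem {T : Type} {Q : Type*} [Preorder Q]
    (hT : Cardinal.mk T ≤ Cardinal.aleph 1)
    (hQ : ∀ C : Set Q, C.Countable → IsChain (· ≤ ·) C → BddAbove C)
    (D : T → Set Q) (hD : ∀ t q, ∃ q' ∈ D t, q ≤ q') :
    ∃ g : T → Q, (∀ s t, g s ≤ g t ∨ g t ≤ g s) ∧ ∀ t, g t ∈ D t := by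
  -- A well-order of least possible type has proper initial segments of cardinality below `ℵ₁`.
  obtain ⟨_, _, h⟩ := Cardinal.exists_ord_eq_type_lt T
  have hI (t : T) : (Iio t).Countable := by
    rw [← Cardinal.le_aleph0_iff_set_countable, ← Order.lt_succ_iff, ← Cardinal.aleph_zero,
      Cardinal.succ_aleph, zero_add]
    exact (Cardinal.mk_Iio_lt t h).trans_le hT
  obtain ⟨g, hg, hD⟩ := exists_monotone_forall_mem hI hQ D hD
  exact ⟨g, fun s t ↦ (le_total s t).imp (fun h ↦ hg h) fun h ↦ hg h, hD⟩

/-- Take for `j n` the largest `j ≤ n` with `R j n`. The relation `R 0 n`, true for large `n`,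
ensures that such a `j` exists. -/
theorem exists_tendsto_atTop_and_eventually {R : ℕ → ℕ → Prop} (h : ∀ j, ∀ᶠ n in atTop, R j n) :
    ∃ j : ℕ → ℕ, Tendsto j atTop atTop ∧ ∀ᶠ n in atTop, R (j n) n := by
  classical
  refine ⟨fun n ↦ Nat.findGreatest (R · n) n, tendsto_atTop.2 fun b ↦ ?_, ?_⟩
  · filter_upwards [h b, eventually_ge_atTop b] with n hn hb
    exact Nat.le_findGreatest hb hn
  · filter_upwards [h 0] with n hn
    exact Nat.findGreatest_spec (P := (R · n)) (Nat.zero_le n) hn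

/-! ### The sum of countably many convergent sequences -/

/-- A disjoint union of countably many convergent sequences. -/
abbrev SeqSum : Type := ℕ × OnePoint ℕ

namespace SeqSum

/-- The `i`-th limit point. -/
abbrev lim (i : ℕ) : SeqSum := (i, OnePoint.infty)

/-- The `m`-th isolated point of the `i`-th sequence. -/
abbrev pt (i m : ℕ) : SeqSum := (i, (m : OnePoint ℕ))

theorem eq_lim_or_pt (p : SeqSum) : p = lim p.1 ∨ ∃ m, p = pt p.1 m := by
  obtain ⟨i, o⟩ := p
  induction o using OnePoint.rec with
  | infty => exact Or.inl rfl
  | coe m => exact Or.inr ⟨m, rfl⟩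

theorem isOpen_singleton_pt (i m : ℕ) : IsOpen {pt i m} := by
  have h : IsOpen ({(m : OnePoint ℕ)} : Set (OnePoint ℕ)) := by
    simpa using OnePoint.isOpenEmbedding_coe.isOpenMap {m} (isOpen_discrete _)
  simpa [singleton_prod_singleton] using (isOpen_discrete {i}).prod h

theorem isOpen_of_forall_lim_notMem {H : Set SeqSum} (h : ∀ i, lim i ∉ H) : IsOpen H := by
  rw [isOpen_iff_forall_mem_open]
  intro p hp
  rcases eq_lim_or_pt p with h' | ⟨m, h'⟩
  · exact absurd (h' ▸ hp) (h _)
  · exact ⟨{p}, by simpa using hp, h' ▸ isOpen_singleton_pt _ _, rfl⟩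

theorem tendsto_pt (i : ℕ) : Tendsto (pt i) atTop (𝓝 (lim i)) := by
  refine Filter.Tendsto.prodMk_nhds tendsto_const_nhds ?_
  rw [OnePoint.nhds_infty_eq]
  refine Tendsto.mono_right ?_ le_sup_left
  rw [coclosedCompact_eq_cocompact, cocompact_eq_cofinite, Nat.cofinite_eq_atTop]
  exact tendsto_map

theorem isClopen_fst_preimage (s : Set ℕ) : IsClopen (Prod.fst ⁻¹' s : Set SeqSum) :=
  (isClopen_discrete s).preimage continuous_fst

/-- A union of closed sets of which only finitely many meet each sequence is closed. -/
theorem isClosed_iUnion {A : ℕ → Set SeqSum} (hA : ∀ n, IsClosed (A n))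
    (h : ∀ n, ∀ p ∈ A n, n ≤ p.1) : IsClosed (⋃ n, A n) := by
  refine LocallyFinite.isClosed_iUnion (fun p ↦ ?_) hA
  refine ⟨Prod.fst ⁻¹' {p.1}, (isClopen_fst_preimage _).isOpen.mem_nhds rfl, ?_⟩
  refine (finite_Iic p.1).subset ?_
  rintro n ⟨q, hq, hqp⟩
  have := h n q hq
  rw [mem_preimage, mem_singleton_iff] at hqp
  exact hqp ▸ this

end SeqSum

/-! ### Neighbourhoods in `ω + 1` -/

namespace OmegaAddOne

/-- The finite ordinal `n`. -/
noncomputable def ofNat (n : ℕ) : OmegaAddOne :=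
  ⟨n, mem_Iio.2 ((Ordinal.natCast_lt_omega0 n).trans (Order.lt_add_one_iff.2 le_rfl))⟩

/-- The ordinal `ω`. -/
noncomputable def top : OmegaAddOne := ⟨Ordinal.omega0, mem_Iio.2 (Order.lt_add_one_iff.2 le_rfl)⟩

theorem coe_ofNat (n : ℕ) : (ofNat n : Ordinal) = n := rfl

theorem coe_top : (top : Ordinal) = Ordinal.omega0 := rfl

theorem ofNat_lt_top (n : ℕ) : ofNat n < top :=
  Subtype.coe_lt_coe.1 (by rw [coe_ofNat, coe_top]; exact Ordinal.natCast_lt_omega0 n)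

theorem eq_ofNat_or_eq_top (y : OmegaAddOne) : (∃ n, y = ofNat n) ∨ y = top := by
  obtain ⟨o, ho⟩ := y
  rcases (Order.lt_add_one_iff.1 (mem_Iio.1 ho)).lt_or_eq with h | h
  · obtain ⟨n, rfl⟩ := Ordinal.lt_omega0.1 h
    exact Or.inl ⟨n, rfl⟩
  · exact Or.inr (Subtype.ext h)

theorem ofNat_ne_top (n : ℕ) : ofNat n ≠ top := (ofNat_lt_top n).ne

theorem ofNat_injective : Function.Injective ofNat := fun m n h ↦ by
  simpa [ofNat] using congrArg Subtype.val h

theorem nhds_ofNat (n : ℕ) : 𝓝 (ofNat n) = pure (ofNat n) := by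
  rw [nhds_subtype_eq_comap]
  have : 𝓝 ((ofNat n : OmegaAddOne) : Ordinal) = pure (n : Ordinal) :=
    SuccOrder.nhds_eq_pure.2 fun h ↦ by
      simpa using (Ordinal.omega0_le_of_isSuccLimit h).trans_lt (Ordinal.natCast_lt_omega0 n)
  rw [this, comap_pure]
  ext s
  simp only [mem_principal, mem_pure]
  refine ⟨fun h ↦ h rfl, fun h x hx ↦ ?_⟩
  rwa [show x = ofNat n from Subtype.ext hx]

theorem mem_nhds_top {s : Set OmegaAddOne} :
    s ∈ 𝓝 top ↔ top ∈ s ∧ ∀ᶠ n in atTop, ofNat n ∈ s := by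
  constructor
  · intro h
    refine ⟨mem_of_mem_nhds h, ?_⟩
    rw [nhds_subtype_eq_comap] at h
    obtain ⟨t, ht, hts⟩ := h
    rw [coe_top] at ht
    obtain ⟨a, ha, hat⟩ := exists_Ioc_subset_of_mem_nhds ht ⟨0, Ordinal.omega0_pos⟩
    obtain ⟨N, rfl⟩ := Ordinal.lt_omega0.1 ha
    filter_upwards [eventually_gt_atTop N] with n hn
    refine hts (hat ⟨?_, (Ordinal.natCast_lt_omega0 n).le⟩)
    simpa [ofNat] using hn
  · rintro ⟨h, hs⟩
    obtain ⟨N, hN⟩ := eventually_atTop.1 hs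
    refine mem_of_superset (Ioi_mem_nhds (ofNat_lt_top N)) ?_
    intro y hy
    rcases eq_ofNat_or_eq_top y with ⟨n, rfl⟩ | rfl
    · refine hN n (le_of_lt ?_)
      have := Subtype.coe_lt_coe.2 (show ofNat N < ofNat n from mem_Ioi.1 hy)
      rw [coe_ofNat, coe_ofNat] at this
      exact_mod_cast this
    · exact h

end OmegaAddOne

/-! ### Selections on `ω + 1` as convergent sequences -/

/-- Convergent selections of sequences of sets at a point. -/
def HasSeqSelection {X : Type*} [TopologicalSpace X] (x : X) (A : ℕ → Set X) : Prop :=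
  (∀ U ∈ 𝓝 x, ∀ᶠ n in atTop, (A n ∩ U).Nonempty) →
    ∃ s : ℕ → X, (∀ n, s n ∈ A n) ∧ Tendsto s atTop (𝓝 x)

open OmegaAddOne in
-- Finite ordinals are isolated, so after any choice of value at `ω` only convergence to that value
-- matters.
theorem isLSelective_of_hasSeqSelection {X : Type*} [TopologicalSpace X]
    (h : ∀ (x : X) (A : ℕ → Set X), (∀ n, (A n).Nonempty ∧ IsClosed (A n)) →
      HasSeqSelection x A) : IsLSelective X := by
  intro φ hφ hl
  obtain ⟨x, hx⟩ := (hφ top).1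
  obtain ⟨s, hs, hsx⟩ := h x (fun n ↦ φ (ofNat n)) (fun n ↦ hφ _) fun U hU ↦ by
    obtain ⟨V, hVU, hV, hxV⟩ := mem_nhds_iff.1 hU
    refine (mem_nhds_top.1 (lowerHemicontinuousAt_iff.1 (hl top) V hV ⟨x, hx, hxV⟩)).2.mono ?_
    exact fun n hn ↦ hn.mono (inter_subset_inter_right _ hVU)
  have (y : OmegaAddOne) : ∃ z ∈ φ y, (∀ n, y = ofNat n → z = s n) ∧ (y = top → z = x) := by
    rcases eq_ofNat_or_eq_top y with ⟨n, rfl⟩ | rfl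
    · exact ⟨s n, hs n, fun m hm ↦ congrArg s (ofNat_injective hm),
        fun h ↦ absurd h (ofNat_ne_top n)⟩
    · exact ⟨x, hx, fun n hn ↦ absurd hn.symm (ofNat_ne_top n), fun _ ↦ rfl⟩
  choose f hfφ hfs hfx using this
  refine ⟨f, continuous_iff_continuousAt.2 fun y ↦ ?_, hfφ⟩
  rcases eq_ofNat_or_eq_top y with ⟨n, rfl⟩ | rfl
  · rw [ContinuousAt, nhds_ofNat]
    exact tendsto_pure_nhds _ _
  · intro U hU
    rw [hfx _ rfl] at hU
    refine mem_nhds_top.2 ⟨?_, ?_⟩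
    · rw [mem_preimage, hfx _ rfl]
      exact mem_of_mem_nhds hU
    · filter_upwards [hsx hU] with n hn
      rwa [mem_preimage, hfs _ n rfl]

open OmegaAddOne in
theorem IsStronglyLSelective.hasSeqSelection {X : Type*} [TopologicalSpace X]
    (h : IsStronglyLSelective X) (x : X) (A : ℕ → Set X) (hA : ∀ n, (A n).Nonempty) :
    HasSeqSelection x A := by
  classical
  intro hx
  let φ (y : OmegaAddOne) : Set X := {z | (∀ n, y = ofNat n → z ∈ A n) ∧ (y = top → z = x)}
  have hφn (n : ℕ) : φ (ofNat n) = A n := by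
    ext z
    refine ⟨fun hz ↦ hz.1 n rfl, fun hz ↦ ⟨fun m hm ↦ ofNat_injective hm ▸ hz,
      fun h ↦ absurd h (ofNat_ne_top n)⟩⟩
  have hφt : φ top = {x} := by
    ext z
    exact ⟨fun hz ↦ hz.2 rfl, fun hz ↦ ⟨fun n hn ↦ absurd hn.symm (ofNat_ne_top n), fun _ ↦ hz⟩⟩
  obtain ⟨f, hf, hfφ⟩ := h φ (fun y ↦ by
      rcases eq_ofNat_or_eq_top y with ⟨n, rfl⟩ | rfl
      · rw [hφn]; exact hA n
      · rw [hφt]; exact singleton_nonempty x) (fun y ↦ lowerHemicontinuousAt_iff.2 fun U hU hy ↦ by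
      rcases eq_ofNat_or_eq_top y with ⟨n, rfl⟩ | rfl
      · rw [nhds_ofNat]
        exact hy
      · refine mem_nhds_top.2 ⟨hy, ?_⟩
        rw [hφt, singleton_inter_nonempty] at hy
        filter_upwards [hx U (hU.mem_nhds hy)] with n hn
        rwa [← hφn] at hn)
  refine ⟨fun n ↦ f (ofNat n), fun n ↦ hφn n ▸ hfφ _, ?_⟩
  have hfx : f top = x := by simpa [hφt] using hfφ top
  have hc := hf.tendsto top
  rw [hfx] at hc
  exact hc.comp fun U hU ↦ (mem_nhds_top.1 hU).2

/-- Sequences of sets have convergent selections at points of first countability. -/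
theorem hasSeqSelection_of_isCountablyGenerated {X : Type*} [TopologicalSpace X] {x : X}
    [(𝓝 x).IsCountablyGenerated] {A : ℕ → Set X} (hA : ∀ n, (A n).Nonempty) :
    HasSeqSelection x A := by
  classical
  intro h
  obtain ⟨U, hU⟩ := (𝓝 x).exists_antitone_basis
  obtain ⟨j, hj, hR⟩ := exists_tendsto_atTop_and_eventually fun k ↦ h (U k) (hU.mem k)
  have (n : ℕ) : ∃ z ∈ A n, (A n ∩ U (j n)).Nonempty → z ∈ U (j n) := by
    by_cases hn : (A n ∩ U (j n)).Nonempty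
    · exact ⟨hn.some, hn.some_mem.1, fun _ ↦ hn.some_mem.2⟩
    · exact ⟨(hA n).some, (hA n).some_mem, fun h ↦ absurd h hn⟩
  choose s hs hsU using this
  refine ⟨s, hs, hU.1.tendsto_right_iff.2 fun k _ ↦ ?_⟩
  filter_upwards [hR, hj.eventually_ge_atTop k] with n hn hk
  exact hU.2 hk (hsU n hn)

/-! ### Countable approximations and their extensions -/

/-- A countable approximation to a filter on `SeqSum`: a countably generated filter `G`, a set `S`
of sequences that have to converge along all stronger approximations, and a filter `F` on `ℕ`
whose sets are almost avoided by the sequences in `S`. -/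
structure SeqSum.Approx where
  F : Filter ℕ
  G : Filter SeqSum
  S : Set (ℕ → SeqSum)
  neBot_F : F.NeBot
  isCountablyGenerated_F : F.IsCountablyGenerated
  F_le : F ≤ atTop
  isCountablyGenerated_G : G.IsCountablyGenerated
  G_le : G ≤ comap Prod.fst atTop
  exists_isClopen : ∀ A ∈ G, ∃ B ∈ G, B ⊆ A ∧ IsClopen B
  tendsto_lim : Tendsto lim atTop G
  tendsto_of_mem : ∀ s ∈ S, Tendsto s atTop G
  eventually_of_mem : ∀ s ∈ S, ∃ C ∈ F, ∀ᶠ n in atTop, s n = lim (s n).1 ∨ (s n).1 ∉ C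

namespace SeqSum.Approx

attribute [instance] neBot_F isCountablyGenerated_F isCountablyGenerated_G

instance : Preorder Approx where
  le p q := q.F ≤ p.F ∧ q.G ≤ p.G ∧ p.S ⊆ q.S
  le_refl p := ⟨le_rfl, le_rfl, subset_rfl⟩
  le_trans p q r h h' := ⟨h'.1.trans h.1, h'.2.1.trans h.2.1, h.2.2.trans h'.2.2⟩

instance : Nonempty Approx := ⟨{
  F := atTop
  G := comap Prod.fst atTop
  S := ∅
  neBot_F := inferInstance
  isCountablyGenerated_F := inferInstance
  F_le := le_rfl
  isCountablyGenerated_G := inferInstance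
  G_le := le_rfl
  exists_isClopen := by
    rintro A ⟨t, ht, htA⟩
    exact ⟨_, preimage_mem_comap ht, htA, isClopen_fst_preimage t⟩
  tendsto_lim := tendsto_comap_iff.2 tendsto_id
  tendsto_of_mem := by simp
  eventually_of_mem := by simp }⟩

section Directed

variable {ι : Type*} {f : ι → Approx}

theorem directed_F (hf : ∀ i j, f i ≤ f j ∨ f j ≤ f i) : Directed (· ≥ ·) fun i ↦ (f i).F := fun i j ↦ by
  rcases hf i j with h | h
  · exact ⟨j, h.1, le_rfl⟩
  · exact ⟨i, le_rfl, h.1⟩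

theorem mem_iInf_G [Nonempty ι] (hf : ∀ i j, f i ≤ f j ∨ f j ≤ f i) {A : Set SeqSum} :
    A ∈ ⨅ i, (f i).G ↔ ∃ i, A ∈ (f i).G := by
  refine mem_iInf_of_directed (fun i j ↦ ?_) A
  rcases hf i j with h | h
  · exact ⟨j, h.2.1, le_rfl⟩
  · exact ⟨i, le_rfl, h.2.1⟩

theorem tendsto_iInf_G (hf : ∀ i j, f i ≤ f j ∨ f j ≤ f i) {i : ι} {s : ℕ → SeqSum}
    (hs : s ∈ (f i).S) :
    Tendsto s atTop (⨅ i, (f i).G) :=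
  tendsto_iInf.2 fun j ↦ by
    rcases hf i j with h | h
    · exact (f j).tendsto_of_mem s (h.2.2 hs)
    · exact ((f i).tendsto_of_mem s hs).mono_right h.2.1

theorem exists_isClopen_iInf_G [Nonempty ι] (hf : ∀ i j, f i ≤ f j ∨ f j ≤ f i)
    {A : Set SeqSum} (hA : A ∈ ⨅ i, (f i).G) :
    ∃ B ∈ ⨅ i, (f i).G, B ⊆ A ∧ IsClopen B := by
  obtain ⟨i, hi⟩ := (mem_iInf_G hf).1 hA
  obtain ⟨B, hB, h⟩ := (f i).exists_isClopen A hi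
  exact ⟨B, (mem_iInf_G hf).2 ⟨i, hB⟩, h⟩

end Directed

/-- Take infima of the filters and the union of the promises. Countability keeps the infima
countably generated; comparability keeps `F` proper, the clopen base of `G`, and the promises. -/
theorem bddAbove_of_isChain {C : Set Approx} (hC : C.Countable) (h : IsChain (· ≤ ·) C) :
    BddAbove C := by
  rcases C.eq_empty_or_nonempty with rfl | hne
  · exact bddAbove_empty
  have := hC.to_subtype
  have := hne.to_subtype
  have hf (p q : C) : (p : Approx) ≤ q ∨ (q : Approx) ≤ p := h.total p.2 q.2
  refine ⟨{
    F := ⨅ p : C, p.1.F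
    G := ⨅ p : C, p.1.G
    S := ⋃ p : C, p.1.S
    neBot_F := iInf_neBot_of_directed (directed_F hf) fun p ↦ p.1.neBot_F
    isCountablyGenerated_F := inferInstance
    F_le := (iInf_le _ (Classical.arbitrary C)).trans (F_le _)
    isCountablyGenerated_G := inferInstance
    G_le := (iInf_le _ (Classical.arbitrary C)).trans (G_le _)
    exists_isClopen := fun A ↦ exists_isClopen_iInf_G hf
    tendsto_lim := tendsto_iInf.2 fun p ↦ p.1.tendsto_lim
    tendsto_of_mem := ?_
    eventually_of_mem := ?_ }, fun p hp ↦ ⟨?_, ?_, ?_⟩⟩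
  · intro s hs
    obtain ⟨p, hp⟩ := mem_iUnion.1 hs
    exact tendsto_iInf_G hf hp
  · intro s hs
    obtain ⟨p, hp⟩ := mem_iUnion.1 hs
    obtain ⟨A, hA, hs⟩ := p.1.eventually_of_mem s hp
    exact ⟨A, mem_iInf_of_mem p hA, hs⟩
  · exact iInf_le (fun p : C ↦ p.1.F) ⟨p, hp⟩
  · exact iInf_le (fun p : C ↦ p.1.G) ⟨p, hp⟩
  · exact subset_iUnion (fun p : C ↦ p.1.S) ⟨p, hp⟩

/-- A closed set of isolated points over a pseudo-intersection of `F` can be removed from `G`. -/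
theorem exists_compl_mem (q : Approx) {u : ℕ → ℕ} (hu : Tendsto u atTop q.F) {H : Set SeqSum}
    (hH : IsClosed H) (hlim : ∀ i, lim i ∉ H) (hHu : ∀ p ∈ H, p.1 ∈ range u) :
    ∃ q', q ≤ q' ∧ Hᶜ ∈ q'.G := by
  have hclopen : IsClopen Hᶜ :=
    ⟨(isOpen_of_forall_lim_notMem hlim).isClosed_compl, hH.isOpen_compl⟩
  refine ⟨{
    F := map u atTop
    G := q.G ⊓ 𝓟 Hᶜ
    S := q.S
    neBot_F := inferInstance
    isCountablyGenerated_F := inferInstance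
    F_le := hu.trans q.F_le
    isCountablyGenerated_G := inferInstance
    G_le := inf_le_left.trans q.G_le
    exists_isClopen := ?_
    tendsto_lim := tendsto_inf.2 ⟨q.tendsto_lim, tendsto_principal.2 <| .of_forall hlim⟩
    tendsto_of_mem := ?_
    eventually_of_mem := ?_ }, ⟨hu, inf_le_left, subset_rfl⟩,
    mem_inf_of_right (mem_principal_self _)⟩
  · intro A hA
    obtain ⟨B, hB, hBA, hBc⟩ := q.exists_isClopen _ (mem_inf_principal.1 hA)
    refine ⟨B ∩ Hᶜ, inter_mem_inf hB (mem_principal_self _), fun x hx ↦ hBA hx.1 hx.2,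
      hBc.inter hclopen⟩
  · intro s hs
    refine tendsto_inf.2 ⟨q.tendsto_of_mem s hs, tendsto_principal.2 ?_⟩
    obtain ⟨C, hC, hsC⟩ := q.eventually_of_mem s hs
    -- All but finitely many values of `u` lie in `C`, and the columns of `s` tend to infinity, so
    -- `s` eventually leaves `H`.
    obtain ⟨M, hM⟩ := eventually_atTop.1 (hu hC)
    obtain ⟨N, hN⟩ := ((finite_Iio M).image u).bddAbove
    have h1 : Tendsto (fun n ↦ (s n).1) atTop atTop :=
      tendsto_comap_iff.1 ((q.tendsto_of_mem s hs).mono_right q.G_le)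
    filter_upwards [hsC, h1.eventually_gt_atTop N] with n hn hnN hnH
    rcases hn with hn | hn
    · exact hlim _ (hn ▸ hnH)
    · obtain ⟨m, hm⟩ := hHu _ hnH
      rcases lt_or_ge m M with h | h
      · exact (hN (mem_image_of_mem u h)).not_gt (hm ▸ hnN)
      · exact hn (hm ▸ hM m h)
  · intro s hs
    obtain ⟨C, hC, hsC⟩ := q.eventually_of_mem s hs
    exact ⟨C, hu hC, hsC⟩

/-- A sequence that converges along `G` and lives over the complement of a pseudo-intersection of
`F` can be added to `S`. -/
theorem exists_mem_S (q : Approx) {c : ℕ → ℕ} (hc : Tendsto c atTop q.F) {s : ℕ → SeqSum}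
    (hs : Tendsto s atTop q.G)
    (hsc : ∀ᶠ n in atTop, s n = lim (s n).1 ∨ (s n).1 ∉ range c) :
    ∃ q', q ≤ q' ∧ s ∈ q'.S := by
  refine ⟨{
    F := map c atTop
    G := q.G
    S := insert s q.S
    neBot_F := inferInstance
    isCountablyGenerated_F := inferInstance
    F_le := hc.trans q.F_le
    isCountablyGenerated_G := inferInstance
    G_le := q.G_le
    exists_isClopen := q.exists_isClopen
    tendsto_lim := q.tendsto_lim
    tendsto_of_mem := ?_
    eventually_of_mem := ?_ }, ⟨hc, le_rfl, subset_insert _ _⟩, mem_insert _ _⟩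
  · rintro t (rfl | ht)
    · exact hs
    · exact q.tendsto_of_mem t ht
  · rintro t (rfl | ht)
    · exact ⟨range c, range_mem_map, hsc⟩
    · obtain ⟨C, hC, h⟩ := q.eventually_of_mem t ht
      exact ⟨C, hc hC, h⟩

/-- The points of the transversal over `range u` form a closed set, one point per column, and can be
removed. -/
theorem exists_not_tendsto_pt (q : Approx) (f : ℕ → ℕ) :
    ∃ q', q ≤ q' ∧ ¬ Tendsto (fun n ↦ pt n (f n)) atTop q'.G := by
  obtain ⟨u, hu⟩ := exists_seq_tendsto q.F
  have hu' : Tendsto u atTop atTop := hu.mono_right q.F_le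
  obtain ⟨q', hq, hH⟩ := q.exists_compl_mem hu (H := ⋃ n, {p | p = pt n (f n) ∧ n ∈ range u})
    (isClosed_iUnion (fun n ↦ ((finite_singleton (pt n (f n))).subset fun p hp ↦ hp.1).isClosed)
      (fun n p hp ↦ by rw [hp.1])) (fun i hi ↦ by simp at hi) (fun p hp ↦ by
        obtain ⟨n, rfl, hn⟩ := mem_iUnion.1 hp
        exact hn)
  refine ⟨q', hq, fun h ↦ ?_⟩
  obtain ⟨n, hn⟩ := (hu'.eventually (h hH)).exists
  exact hn (mem_iUnion.2 ⟨u n, rfl, mem_range_self n⟩)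

/-- `Z l` consists of the points that are safe to promise: limits, points off the reserved columns,
and points in columns below `l`. If, for some basic neighbourhood, infinitely many `A n` miss its
safe part for every `l`, the traces of suitable `A (n l)` lie over reserved columns beyond `l`;
their union is closed and can be removed. Otherwise safe points can be selected diagonally. -/
theorem exists_selection_or (q : Approx) {A : ℕ → Set SeqSum}
    (hA : ∀ n, (A n).Nonempty ∧ IsClosed (A n)) :
    ∃ q', q ≤ q' ∧ ((∃ B ∈ q'.G, ∃ᶠ n in atTop, ¬ (A n ∩ B).Nonempty) ∨
      ∃ s ∈ q'.S, ∀ n, s n ∈ A n) := by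
  obtain ⟨u, hu⟩ := exists_seq_tendsto q.F
  have hu' : Tendsto u atTop atTop := hu.mono_right q.F_le
  obtain ⟨U, hU⟩ := q.G.exists_antitone_basis
  let Z (l : ℕ) : Set SeqSum := {p | p = lim p.1 ∨ p.1 ∉ range u ∨ p.1 < l}
  have hV (k : ℕ) : U k ∩ {p | k ≤ p.1} ∈ q.G :=
    inter_mem (hU.mem k) (q.G_le (preimage_mem_comap (Ici_mem_atTop k)))
  by_cases h : ∃ k, ∀ l, ∃ᶠ n in atTop, ¬ (A n ∩ (U k ∩ {p | k ≤ p.1}) ∩ Z l).Nonempty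
  · obtain ⟨k, hk⟩ := h
    obtain ⟨B, hB, hBU, hBc⟩ := q.exists_isClopen _ (hV k)
    obtain ⟨n, hn, hnA⟩ := extraction_forall_of_frequently hk
    have hAB (l : ℕ) (p : SeqSum) (hp : p ∈ A (n l) ∩ B) :
        p ≠ lim p.1 ∧ p.1 ∈ range u ∧ l ≤ p.1 := by
      have : p ∉ Z l := fun hpZ ↦ hnA l ⟨p, ⟨hp.1, hBU hp.2⟩, hpZ⟩
      simpa [Z, not_or] using this
    obtain ⟨q', hq, hH⟩ := q.exists_compl_mem hu (H := ⋃ l, A (n l) ∩ B)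
      (isClosed_iUnion (fun l ↦ (hA _).2.inter hBc.1) fun l p hp ↦ (hAB l p hp).2.2)
      (fun i hi ↦ by
        obtain ⟨l, hl⟩ := mem_iUnion.1 hi
        exact (hAB l _ hl).1 rfl)
      (fun p hp ↦ by
        obtain ⟨l, hl⟩ := mem_iUnion.1 hp
        exact (hAB l _ hl).2.1)
    refine ⟨q', hq, Or.inl ⟨_, inter_mem (hq.2.1 hB) hH, ?_⟩⟩
    refine hn.tendsto_atTop.frequently (Frequently.of_forall fun l ↦ ?_)
    rintro ⟨p, hpA, hpB, hp⟩
    exact hp (mem_iUnion.2 ⟨l, hpA, hpB⟩)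
  · push Not at h
    choose l hl using h
    -- Thin `u` to `c` with gaps so long that a column which is at least `c j + 1` and below `l (c j
    -- + 1)` lies strictly between `c j` and `c (j + 1)`, hence outside `range c`.
    have hψ (a : ℕ) : ∃ b > a, max (l (u a + 1)) (u a + 1) ≤ u b :=
      ((eventually_gt_atTop a).and (hu'.eventually_ge_atTop _)).exists
    choose ψ hψ hψu using hψ
    let v (j : ℕ) : ℕ := ψ^[j] 0
    have hv1 (j : ℕ) : v (j + 1) = ψ (v j) := Function.iterate_succ_apply' ψ j 0
    have hv : StrictMono v := strictMono_nat_of_lt_succ fun j ↦ hv1 j ▸ hψ _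
    let c (j : ℕ) : ℕ := u (v j)
    have hcl (j : ℕ) : max (l (c j + 1)) (c j + 1) ≤ c (j + 1) := by
      simp only [c, hv1]; exact hψu _
    have hc : StrictMono c := strictMono_nat_of_lt_succ fun j ↦ (le_max_right _ _).trans (hcl j)
    have hcF : Tendsto c atTop q.F := hu.comp hv.tendsto_atTop
    obtain ⟨j, hj, hjA⟩ := exists_tendsto_atTop_and_eventually fun j ↦ hl (c j + 1)
    let W (j : ℕ) : Set SeqSum := U (c j + 1) ∩ {p | c j + 1 ≤ p.1} ∩ Z (l (c j + 1))
    have (n : ℕ) : ∃ z ∈ A n, (A n ∩ W (j n)).Nonempty → z ∈ W (j n) := by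
      by_cases hn : (A n ∩ W (j n)).Nonempty
      · exact ⟨hn.some, hn.some_mem.1, fun _ ↦ hn.some_mem.2⟩
      · exact ⟨(hA n).1.some, (hA n).1.some_mem, fun h ↦ absurd h hn⟩
    choose s hsA hsW using this
    have hs : ∀ᶠ n in atTop, s n ∈ W (j n) :=
      hjA.mono fun n hn ↦ hsW n (by rwa [inter_assoc] at hn)
    have hsG : Tendsto s atTop q.G := by
      refine hU.1.tendsto_right_iff.2 fun k _ ↦ ?_
      filter_upwards [hs, hj.eventually_ge_atTop k] with n hn hk
      exact hU.2 ((hk.trans hc.le_apply).trans (Nat.le_succ _)) hn.1.1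
    have hsc : ∀ᶠ n in atTop, s n = lim (s n).1 ∨ (s n).1 ∉ range c := by
      filter_upwards [hs] with n hn
      rcases hn.2 with h | h | h
      · exact Or.inl h
      · exact Or.inr fun ⟨i, hi⟩ ↦ h ⟨v i, hi⟩
      · refine Or.inr ?_
        rintro ⟨i, hi⟩
        rcases le_or_gt i (j n) with hij | hij
        · have h1 := hc.monotone hij
          have h2 : c (j n) + 1 ≤ (s n).1 := hn.1.2
          omega
        · have h1 := hc.monotone (Nat.succ_le_of_lt hij)
          have h2 := (le_max_left _ _).trans (hcl (j n))
          rw [Nat.succ_eq_add_one] at h1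
          omega
    obtain ⟨q', hq, hsq⟩ := q.exists_mem_S hcF hsG hsc
    exact ⟨q', hq, Or.inr ⟨s, hsq, hsA⟩⟩

end SeqSum.Approx

/-! ### The filter obtained from the continuum hypothesis -/

open SeqSum

/-- Under the continuum hypothesis, there is a filter on `SeqSum` along which closed sets have
convergent selections and no transversal of the sequences converges. -/
theorem exists_filter_of_continuum_eq_aleph_one (hCH : Cardinal.continuum.{0} = Cardinal.aleph 1) :
    ∃ G : Filter SeqSum, G ≤ comap Prod.fst atTop ∧
      (∀ A ∈ G, ∃ B ∈ G, B ⊆ A ∧ IsClopen B) ∧ Tendsto lim atTop G ∧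
      (∀ f : ℕ → ℕ, ¬ Tendsto (fun n ↦ pt n (f n)) atTop G) ∧
      ∀ A : ℕ → Set SeqSum, (∀ n, (A n).Nonempty ∧ IsClosed (A n)) →
        (∀ B ∈ G, ∀ᶠ n in atTop, (A n ∩ B).Nonempty) →
          ∃ s : ℕ → SeqSum, (∀ n, s n ∈ A n) ∧ Tendsto s atTop G := by
  -- A task pairs a transversal to defeat with a sequence of sets to treat; there are continuum many
  -- since `SeqSum` is countable.
  let T : Type := (ℕ → ℕ) × (ℕ → Set SeqSum)
  have hT : Cardinal.mk T ≤ Cardinal.aleph 1 := by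
    have : Countable SeqSum := inferInstanceAs (Countable (ℕ × Option ℕ))
    rw [← hCH, Cardinal.mk_prod, Cardinal.lift_id, Cardinal.lift_id, ← Cardinal.power_def,
      ← Cardinal.power_def, Cardinal.mk_set, Cardinal.mk_nat, Cardinal.aleph0_power_aleph0,
      Cardinal.mk_eq_aleph0 SeqSum, ← Cardinal.power_mul, Cardinal.aleph0_mul_aleph0,
      Cardinal.two_power_aleph0, Cardinal.continuum_mul_self]
  obtain ⟨g, hg, hgD⟩ := exists_directed_forall_mem (Q := Approx) hT
    (fun C hC h ↦ Approx.bddAbove_of_isChain hC h)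
    (fun t ↦ {q | ¬ Tendsto (fun n ↦ pt n (t.1 n)) atTop q.G ∧
      ((∀ n, (t.2 n).Nonempty ∧ IsClosed (t.2 n)) →
        (∃ B ∈ q.G, ∃ᶠ n in atTop, ¬ (t.2 n ∩ B).Nonempty) ∨ ∃ s ∈ q.S, ∀ n, s n ∈ t.2 n)})
    (fun t q ↦ by
      obtain ⟨q', hq, h⟩ := q.exists_not_tendsto_pt t.1
      by_cases hA : ∀ n, (t.2 n).Nonempty ∧ IsClosed (t.2 n)
      · obtain ⟨q'', hq', h'⟩ := q'.exists_selection_or hA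
        exact ⟨q'', ⟨fun h2 ↦ h (h2.mono_right hq'.2.1), fun _ ↦ h'⟩, hq.trans hq'⟩
      · exact ⟨q', ⟨h, fun h' ↦ absurd h' hA⟩, hq⟩)
  let t₀ : T := (fun _ ↦ 0, fun _ ↦ ∅)
  have : Nonempty T := ⟨t₀⟩
  refine ⟨⨅ t, (g t).G, (iInf_le _ t₀).trans (g t₀).G_le,
    fun A ↦ Approx.exists_isClopen_iInf_G hg, tendsto_iInf.2 fun t ↦ (g t).tendsto_lim,
    fun f hf ↦ (hgD (f, fun _ ↦ ∅)).1 (tendsto_iInf.1 hf _), fun A hA hAG ↦ ?_⟩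
  rcases (hgD (t₀.1, A)).2 hA with ⟨B, hB, hBA⟩ | ⟨s, hs, hsA⟩
  · exact absurd (hAG B (mem_iInf_of_mem _ hB)) (by simpa [Filter.Frequently] using hBA)
  · exact ⟨s, hsA, Approx.tendsto_iInf_G hg hs⟩

instance SeqSum.instFirstCountableTopology : FirstCountableTopology SeqSum := by
  refine ⟨fun ⟨i, o⟩ ↦ ?_⟩
  have : (𝓝 o).IsCountablyGenerated := by
    induction o using OnePoint.rec with
    | infty =>
      rw [OnePoint.nhds_infty_eq, coclosedCompact_eq_cocompact, cocompact_eq_cofinite,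
        Nat.cofinite_eq_atTop]
      infer_instance
    | coe m =>
      rw [OnePoint.nhds_coe_eq]
      infer_instance
  rw [nhds_prod_eq]
  infer_instance

/-! ### The space with the additional point -/

/-- The space `SeqSum` with one more point, whose neighbourhoods are given by the filter `G`. -/
def SeqSum.AddPoint (_ : Filter SeqSum) : Type := Option SeqSum

namespace SeqSum.AddPoint

variable {G : Filter SeqSum}

/-- The inclusion of `SeqSum`. -/
def of (p : SeqSum) : AddPoint G := Option.some p

/-- The additional point. -/
def point : AddPoint G := Option.none

theorem of_injective : Function.Injective (of : SeqSum → AddPoint G) := Option.some_injective _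

theorem of_ne_point (p : SeqSum) : (of p : AddPoint G) ≠ point := Option.some_ne_none p

theorem eq_point_or_eq_of (x : AddPoint G) : x = point ∨ ∃ p, x = of p := by
  cases x with
  | none => exact Or.inl rfl
  | some p => exact Or.inr ⟨p, rfl⟩

instance : Countable (AddPoint G) := inferInstanceAs (Countable (Option (ℕ × Option ℕ)))

instance : TopologicalSpace (AddPoint G) where
  IsOpen U := IsOpen (of ⁻¹' U : Set SeqSum) ∧ (point ∈ U → of ⁻¹' U ∈ G)
  isOpen_univ := ⟨isOpen_univ, fun _ ↦ univ_mem⟩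
  isOpen_inter U V hU hV := ⟨hU.1.inter hV.1, fun h ↦ inter_mem (hU.2 h.1) (hV.2 h.2)⟩
  isOpen_sUnion S hS := by
    refine ⟨?_, ?_⟩
    · rw [preimage_sUnion]
      exact isOpen_biUnion fun U hU ↦ (hS U hU).1
    · rintro ⟨U, hU, hp⟩
      exact mem_of_superset ((hS U hU).2 hp) (preimage_mono (subset_sUnion_of_mem hU))

theorem isOpen_iff {U : Set (AddPoint G)} :
    IsOpen U ↔ IsOpen (of ⁻¹' U : Set SeqSum) ∧ (point ∈ U → of ⁻¹' U ∈ G) := Iff.rfl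

theorem preimage_image_of (V : Set SeqSum) : of ⁻¹' (of '' V : Set (AddPoint G)) = V :=
  preimage_image_eq V of_injective

theorem continuous_of : Continuous (of : SeqSum → AddPoint G) :=
  continuous_def.2 fun _ hU ↦ (isOpen_iff.1 hU).1

theorem isOpenEmbedding_of : IsOpenEmbedding (of : SeqSum → AddPoint G) := by
  refine .of_continuous_injective_isOpenMap continuous_of of_injective fun V hV ↦ ?_
  refine isOpen_iff.2 ⟨by rwa [preimage_image_of], ?_⟩
  rintro ⟨p, -, hp⟩
  exact absurd hp (of_ne_point p)

instance (p : SeqSum) : (𝓝 (of p : AddPoint G)).IsCountablyGenerated := by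
  rw [← isOpenEmbedding_of.map_nhds_eq]
  infer_instance

theorem preimage_insert_point (B : Set SeqSum) :
    of ⁻¹' (insert point (of '' B) : Set (AddPoint G)) = B := by
  ext p
  simp [of_ne_point, of_injective.eq_iff]

/-- Members of `G` need not be open; the clopen base supplies open ones inside them. -/
theorem mem_nhds_point (hG : ∀ A ∈ G, ∃ B ∈ G, B ⊆ A ∧ IsClopen B) {U : Set (AddPoint G)} :
    U ∈ 𝓝 point ↔ point ∈ U ∧ of ⁻¹' U ∈ G := by
  constructor
  · intro h
    obtain ⟨V, hVU, hV, hp⟩ := mem_nhds_iff.1 h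
    exact ⟨hVU hp, mem_of_superset ((isOpen_iff.1 hV).2 hp) (preimage_mono hVU)⟩
  · rintro ⟨hp, hU⟩
    obtain ⟨B, hB, hBU, hBc⟩ := hG _ hU
    refine mem_nhds_iff.2 ⟨insert point (of '' B), ?_, isOpen_iff.2 ?_, mem_insert _ _⟩
    · rintro x (rfl | ⟨p, hpB, rfl⟩)
      · exact hp
      · exact hBU hpB
    · rw [preimage_insert_point]
      exact ⟨hBc.isOpen, fun _ ↦ hB⟩

theorem tendsto_of (hG : ∀ A ∈ G, ∃ B ∈ G, B ⊆ A ∧ IsClopen B) {s : ℕ → SeqSum} :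
    Tendsto (fun n ↦ (of (s n) : AddPoint G)) atTop (𝓝 point) ↔ Tendsto s atTop G := by
  refine ⟨fun h A hA ↦ ?_, fun h U hU ↦ h ((mem_nhds_point hG).1 hU).2⟩
  have := h ((mem_nhds_point hG).2 ⟨mem_insert _ (of '' A), (preimage_insert_point A).symm ▸ hA⟩)
  rw [← preimage_insert_point (G := G) A]
  exact this

theorem t1Space (hG : G ≤ comap Prod.fst atTop) : T1Space (AddPoint G) := by
  refine ⟨fun x ↦ ⟨isOpen_iff.2 ⟨?_, fun hx ↦ ?_⟩⟩⟩
  · rw [preimage_compl, isOpen_compl_iff]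
    exact ((finite_singleton x).preimage of_injective.injOn).isClosed
  · rcases eq_point_or_eq_of x with rfl | ⟨p, rfl⟩
    · exact absurd rfl hx
    · refine mem_of_superset (hG (preimage_mem_comap (Ioi_mem_atTop p.1))) fun q hq hqp ↦ ?_
      rw [of_injective hqp] at hq
      exact lt_irrefl _ (mem_Ioi.1 (mem_preimage.1 hq))

/-- Convergent selections along `G` for closed sets. -/
def _root_.SeqSum.HasClosedSelections (G : Filter SeqSum) : Prop :=
  ∀ A : ℕ → Set SeqSum, (∀ n, (A n).Nonempty ∧ IsClosed (A n)) →
    (∀ B ∈ G, ∀ᶠ n in atTop, (A n ∩ B).Nonempty) →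
      ∃ s : ℕ → SeqSum, (∀ n, s n ∈ A n) ∧ Tendsto s atTop G

theorem isLSelective [G.NeBot] (hG : ∀ A ∈ G, ∃ B ∈ G, B ⊆ A ∧ IsClopen B)
    (hs : HasClosedSelections G) : IsLSelective (AddPoint G) := by
  classical
  refine isLSelective_of_hasSeqSelection fun x A hA ↦ ?_
  rcases eq_point_or_eq_of x with rfl | ⟨p, rfl⟩
  swap
  · exact hasSeqSelection_of_isCountablyGenerated fun n ↦ (hA n).1
  intro h
  -- Where `point ∈ A n`, the selection will take the value `point`, so `univ` is a harmless
  -- substitute.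
  obtain ⟨s, hsA, hsG⟩ := hs (fun n ↦ if point ∈ A n then univ else of ⁻¹' A n)
    (fun n ↦ by
      split_ifs with hn
      · exact ⟨univ_nonempty, isClosed_univ⟩
      · refine ⟨?_, (hA n).2.preimage continuous_of⟩
        obtain ⟨x, hx⟩ := (hA n).1
        rcases eq_point_or_eq_of x with rfl | ⟨p, rfl⟩
        · exact absurd hx hn
        · exact ⟨p, hx⟩)
    (fun B hB ↦ by
      filter_upwards [h _ ((mem_nhds_point hG).2
        ⟨mem_insert _ (of '' B), (preimage_insert_point B).symm ▸ hB⟩)] with n hn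
      split_ifs with hA
      · simpa using Filter.nonempty_of_mem hB
      · obtain ⟨x, hxA, rfl | ⟨p, hp, rfl⟩⟩ := hn
        · exact absurd hxA hA
        · exact ⟨p, hxA, hp⟩)
  refine ⟨fun n ↦ if point ∈ A n then point else of (s n), fun n ↦ ?_, fun U hU ↦ ?_⟩
  · have := hsA n
    dsimp only at this ⊢
    split_ifs with hn
    · exact hn
    · rwa [if_neg hn] at this
  · have hU' : ∀ᶠ n in atTop, of (s n) ∈ U := (tendsto_of hG).2 hsG hU
    change ∀ᶠ n in atTop, (if point ∈ A n then point else of (s n)) ∈ U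
    filter_upwards [hU'] with n hn
    split_ifs
    · exact mem_of_mem_nhds hU
    · exact hn

/-- The isolated points of column `n` accumulate at `lim n`, and the limits converge to `point`, but
a selection would be a convergent transversal. -/
theorem not_isStronglyLSelective (hG : ∀ A ∈ G, ∃ B ∈ G, B ⊆ A ∧ IsClopen B)
    (hlim : Tendsto lim atTop G) (hf : ∀ f : ℕ → ℕ, ¬ Tendsto (fun n ↦ pt n (f n)) atTop G) :
    ¬ IsStronglyLSelective (AddPoint G) := by
  intro h
  obtain ⟨s, hs, hsG⟩ := h.hasSeqSelection point (fun n ↦ range fun m ↦ of (pt n m))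
    (fun n ↦ range_nonempty _) fun U hU ↦ by
      obtain ⟨B, hB, hBU, hBc⟩ := hG _ ((mem_nhds_point hG).1 hU).2
      filter_upwards [hlim hB] with n hn
      obtain ⟨m, hm⟩ := ((tendsto_pt n).eventually (hBc.isOpen.mem_nhds hn)).exists
      exact ⟨_, ⟨m, rfl⟩, hBU hm⟩
  choose f hf' using hs
  refine hf f ((tendsto_of hG).1 ?_)
  simpa only [hf'] using hsG

/-- If infinitely many limits lie in the closure of `A`, choose sequences in `A` converging to them
inside their columns and let the `n`-th set collect the `n`-th terms. Otherwise `A` is closed beyond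
some column, and the constant sequence of sets serves. -/
theorem _root_.SeqSum.exists_tendsto_of_frequently (hG : G ≤ comap Prod.fst atTop)
    (hopen : ∀ A ∈ G, ∃ B ∈ G, B ⊆ A ∧ IsClopen B)
    (hlim : Tendsto lim atTop G) (hs : HasClosedSelections G) {A : Set SeqSum}
    (hA : ∃ᶠ p in G, p ∈ A) : ∃ s : ℕ → SeqSum, (∀ n, s n ∈ A) ∧ Tendsto s atTop G := by
  by_cases h2 : ∃ᶠ i in atTop, lim i ∈ closure A
  · obtain ⟨φ, hφ, h⟩ := extraction_of_frequently_atTop h2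
    have (j : ℕ) : ∃ v : ℕ → SeqSum, (∀ m, v m ∈ A ∧ (v m).1 = φ j) ∧
        Tendsto v atTop (𝓝 (lim (φ j))) := by
      have h' := (isClopen_fst_preimage {φ j}).isOpen.inter_closure ⟨rfl, h j⟩
      obtain ⟨v, hv, hvt⟩ := mem_closure_iff_seq_limit.1 h'
      exact ⟨v, fun m ↦ ⟨(hv m).2, (hv m).1⟩, hvt⟩
    choose v hv hvt using this
    -- Closed, since `φ` is strictly increasing and each column contains at most one of the points.
    obtain ⟨s, hs, hsG⟩ := hs (fun n ↦ range fun j ↦ v j n) (fun n ↦ ⟨range_nonempty _, by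
        rw [← iUnion_singleton_eq_range]
        exact isClosed_iUnion (fun j ↦ isClosed_singleton) fun j p hp ↦ by
          rw [hp, (hv j n).2]
          exact hφ.le_apply⟩) fun B hB ↦ by
        obtain ⟨C, hC, hCB, hCc⟩ := hopen B hB
        obtain ⟨j, hj⟩ := ((hlim.comp hφ.tendsto_atTop).eventually hC).exists
        filter_upwards [hvt j (hCc.isOpen.mem_nhds hj)] with n hn
        exact ⟨v j n, mem_range_self j, hCB hn⟩
    refine ⟨s, fun n ↦ ?_, hsG⟩
    obtain ⟨j, hj⟩ := hs n
    exact hj ▸ (hv j n).1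
  · obtain ⟨M, hM⟩ := eventually_atTop.1 (not_frequently.1 h2)
    have hset : {p : SeqSum | M ≤ p.1} ∈ G := hG (preimage_mem_comap (Ici_mem_atTop M))
    have hcl : IsClosed (A ∩ {p | M ≤ p.1}) := by
      refine isClosed_of_closure_subset fun p hp ↦ ?_
      have hpM : M ≤ p.1 :=
        closure_minimal inter_subset_right (isClopen_fst_preimage (Ici M)).isClosed hp
      have hpA : p ∈ closure A := closure_mono inter_subset_left hp
      refine ⟨?_, hpM⟩
      rcases eq_lim_or_pt p with h | ⟨m, h⟩
      · exact absurd (h ▸ hpA) (hM _ hpM)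
      · obtain ⟨q, hq, hqA⟩ := mem_closure_iff.1 hpA {p} (h ▸ isOpen_singleton_pt _ _) rfl
        exact mem_singleton_iff.1 hq ▸ hqA
    obtain ⟨s, hs, hsG⟩ := hs (fun _ ↦ A ∩ {p | M ≤ p.1})
      (fun _ ↦ ⟨(hA.and_eventually hset).exists, hcl⟩) fun B hB ↦ .of_forall fun _ ↦ by
        obtain ⟨p, ⟨hpA, hpM⟩, hpB⟩ := ((hA.and_eventually hset).and_eventually hB).exists
        exact ⟨p, ⟨hpA, hpM⟩, hpB⟩
    exact ⟨s, fun n ↦ (hs n).1, hsG⟩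

theorem frechetUrysohnSpace (hG : G ≤ comap Prod.fst atTop)
    (hopen : ∀ A ∈ G, ∃ B ∈ G, B ⊆ A ∧ IsClopen B)
    (hlim : Tendsto lim atTop G) (hs : HasClosedSelections G) :
    FrechetUrysohnSpace (AddPoint G) := by
  refine ⟨fun A x hx ↦ ?_⟩
  rcases eq_point_or_eq_of x with rfl | ⟨p, rfl⟩
  · by_cases hp : point ∈ A
    · exact ⟨fun _ ↦ point, fun _ ↦ hp, tendsto_const_nhds⟩
    obtain ⟨s, hs, hsG⟩ := exists_tendsto_of_frequently hG hopen hlim hs (A := of ⁻¹' A) <| by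
      intro h
      obtain ⟨x, hx, hxA⟩ := mem_closure_iff_nhds.1 hx (insert point (of '' (of ⁻¹' A)ᶜ)) <| by
        refine (mem_nhds_point hopen).2 ⟨mem_insert _ _, mem_of_superset h fun p hp ↦ ?_⟩
        exact Or.inr ⟨p, hp, rfl⟩
      rcases hx with rfl | ⟨p, hp', rfl⟩
      · exact hp hxA
      · exact hp' hxA
    exact ⟨fun n ↦ of (s n), hs, (tendsto_of hopen).2 hsG⟩
  · have := mem_closure_iff_nhdsWithin_neBot.1 hx
    have : (𝓝[A] (of p : AddPoint G)).IsCountablyGenerated := by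
      unfold nhdsWithin; infer_instance
    obtain ⟨s, hs⟩ := exists_seq_tendsto (𝓝[A] (of p : AddPoint G))
    have hs' := tendsto_nhdsWithin_iff.1 hs
    obtain ⟨N, hN⟩ := eventually_atTop.1 hs'.2
    exact ⟨fun n ↦ s (n + N), fun n ↦ hN _ (Nat.le_add_left _ _),
      hs'.1.comp (tendsto_add_atTop_nat N)⟩

end SeqSum.AddPoint

/-! ### The counterexample -/

open SeqSum in
theorem mainTheorem6 (hCH : Cardinal.continuum.{0} = Cardinal.aleph.{0} 1) :
    (∃ (X : Type) (_ : TopologicalSpace X),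
      T1Space X ∧ Countable X ∧ FrechetUrysohnSpace X ∧
        IsLSelective X ∧ ¬ IsStronglyLSelective X) ∧
    ¬ (∀ (X : Type) [TopologicalSpace X] [T1Space X],
      IsStronglyLSelective X ↔ (IsLSelective X ∧ FrechetUrysohnSpace X)) := by
  obtain ⟨G, hG, hopen, hlim, hf, hs⟩ := exists_filter_of_continuum_eq_aleph_one hCH
  have : G.NeBot := hlim.neBot
  have hT1 := AddPoint.t1Space hG
  have hF := AddPoint.frechetUrysohnSpace hG hopen hlim hs
  have hL := AddPoint.isLSelective hopen hs
  have hnL := AddPoint.not_isStronglyLSelective hopen hlim hf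
  exact ⟨⟨AddPoint G, inferInstance, hT1, inferInstance, hF, hL, hnL⟩,
    fun h ↦ hnL ((h (AddPoint G)).2 ⟨hL, hF⟩)⟩
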